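/- Let $F$ be Thompson's group: the group of all strictly increasing piecewise linear homeomorphisms of $[0,1]$ that are differentiable except at finitely many dyadic rationals and whose slopes are integer powers of $2$. Let $x_0,x_1\in F$ be its standard generators, $$x_0(t)=\begin{cases}\frac t2,&0\le t\le\frac12,\\ t-\frac14,&\frac12\le t\le\frac34,\\ 2t-1,&\frac34\le t\le1,\end{cases}\qquad x_1(t)=\begin{cases}t,&0\le t\le\frac12,\\ \frac t2+\frac14,&\frac12\le t\le\frac34,\\ t-\frac18,&\frac34\le t\le\frac78,\\ 2t-1,&\frac78\le t\le1.\end{cases}$$ For $x\in[0,1]$ let $\Gamma_x$ be the Schreier graph of the action of $F$ on the orbit of $x$: its vertices are the points of the orbit $Fx$, and for every vertex $y$ and $i\in\{0,1\}$ there is one arrow, labelled $x_i$, from $y$ to $x_i(y)$ (loops and multiple arrows are kept). **Theorem.** For every $x\in(0,1)$ the automorphism group of $\Gamma_x$ is trivial, in both of the following senses. 1. (Marked graph.) The only permutation of the vertices that is induced by an automorphism of the directed labelled graph $\Gamma_x$ is the identity. 2. (Unmarked graph.) The same holds after labels and directions are forgotten: the only permutation $\sigma$ of the vertices that is induced by an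 automorphism of the underlying undirected multigraph (i.e. for which there is a permutation $\tau$ of the edges such that, for every edge $e$ with end points $u,v$, the edge $\tau(e)$ has end points $\sigma(u),\sigma(v)$) is the identity. -/

import Mathlib

noncomputable section

/-! ## Thompson's group `F` acting on the unit interval -/

/-- A real number of the form `m / 2 ^ n` with `m` an integer and `n` a natural number. -/
def IsDyadic (r : ℝ) : Prop := ∃ (m : ℤ) (n : ℕ), r = m / 2 ^ n

/-- Membership in Thompson's group `F`: a strictly increasing homeomorphism `f` of `[0,1]` for
which there is a finite set `B` of dyadic rationals such that, on every closed interval with no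
point of `B` in its interior, `f` is affine with slope an integer power of `2`. -/
def IsThompson (f : unitInterval ≃ₜ unitInterval) : Prop :=
  StrictMono f ∧ ∃ B : Finset unitInterval, (∀ c ∈ B, IsDyadic (c : ℝ)) ∧
    ∀ a b : unitInterval, a ≤ b → (∀ c ∈ B, ¬ (a < c ∧ c < b)) →
      ∃ k : ℤ, ∀ s ∈ Set.Icc a b, ∀ t ∈ Set.Icc a b,
        (f t : ℝ) - (f s : ℝ) = (2 : ℝ) ^ k * ((t : ℝ) - (s : ℝ))

theorem IsDyadic.add {r s : ℝ} (hr : IsDyadic r) (hs : IsDyadic s) : IsDyadic (r + s) := by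
  obtain ⟨m, n, rfl⟩ := hr
  obtain ⟨m', n', rfl⟩ := hs
  refine ⟨m * 2 ^ n' + m' * 2 ^ n, n + n', ?_⟩
  push_cast
  rw [pow_add]
  field_simp

theorem IsDyadic.neg {r : ℝ} (hr : IsDyadic r) : IsDyadic (-r) := by
  obtain ⟨m, n, rfl⟩ := hr
  exact ⟨-m, n, by push_cast; ring⟩

theorem IsDyadic.zpow_mul {r : ℝ} (hr : IsDyadic r) (k : ℤ) : IsDyadic ((2 : ℝ) ^ k * r) := by
  obtain ⟨m, n, rfl⟩ := hr
  obtain ⟨j, rfl | rfl⟩ := k.eq_nat_or_neg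
  · exact ⟨2 ^ j * m, n, by push_cast; rw [zpow_natCast]; ring⟩
  · refine ⟨m, n + j, ?_⟩
    rw [zpow_neg, zpow_natCast, pow_add]
    field_simp

theorem isDyadic_zero : IsDyadic 0 := ⟨0, 0, by simp⟩

theorem IsThompson.map_zero {f : unitInterval ≃ₜ unitInterval} (hf : IsThompson f) : f 0 = 0 := by
  apply le_antisymm _ unitInterval.nonneg'
  have h := hf.1.monotone (unitInterval.nonneg' (t := f.symm 0))
  rwa [f.apply_symm_apply] at h

theorem IsThompson.isDyadic_iff {f : unitInterval ≃ₜ unitInterval} (hf : IsThompson f)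
    (t : unitInterval) : IsDyadic (f t : ℝ) ↔ IsDyadic (t : ℝ) := by
  obtain ⟨-, B, hB, hl⟩ := id hf
  have key : ∀ a t : unitInterval, a ≤ t → (∀ c ∈ B, ¬ (a < c ∧ c < t)) →
      IsDyadic (a : ℝ) → IsDyadic (f a : ℝ) → (IsDyadic (f t : ℝ) ↔ IsDyadic (t : ℝ)) := by
    intro a t hat hc ha hfa
    obtain ⟨k, hk⟩ := hl a t hat hc
    have h := hk a ⟨le_rfl, hat⟩ t ⟨hat, le_rfl⟩
    constructor
    · intro ht
      have h2 : (t : ℝ) = (2 : ℝ) ^ (-k) * ((f t : ℝ) + -(f a : ℝ)) + a := by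
        rw [← sub_eq_add_neg, h, ← mul_assoc, ← zpow_add₀ (by norm_num)]
        simp
      rw [h2]
      exact ((ht.add hfa.neg).zpow_mul _).add ha
    · intro ht
      have h2 : (f t : ℝ) = (2 : ℝ) ^ k * ((t : ℝ) + -(a : ℝ)) + f a := by
        rw [← sub_eq_add_neg, ← h]; ring
      rw [h2]
      exact ((ht.add ha.neg).zpow_mul _).add hfa
  induction hn : (B.filter (· < t)).card using Nat.strong_induction_on generalizing t with
  | _ n ih =>
    by_cases hne : (B.filter (· < t)).Nonempty
    · have hmem := Finset.max'_mem _ hne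
      set a := (B.filter (· < t)).max' hne with ha
      rw [Finset.mem_filter] at hmem
      have hda : IsDyadic (a : ℝ) := hB a hmem.1
      have hlt : (B.filter (· < a)).card < n := by
        rw [← hn]
        apply Finset.card_lt_card
        refine ⟨fun c hc => ?_, fun hs => ?_⟩
        · rw [Finset.mem_filter] at hc ⊢
          exact ⟨hc.1, hc.2.trans hmem.2⟩
        · have := hs (Finset.mem_filter.2 hmem)
          exact lt_irrefl _ (Finset.mem_filter.1 this).2
      refine key a t hmem.2.le (fun c hc h => ?_) hda ((ih _ hlt a rfl).2 hda)
      exact absurd (Finset.le_max' _ c (Finset.mem_filter.2 ⟨hc, h.2⟩)) (not_le.2 h.1)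
    · refine key 0 t unitInterval.nonneg' (fun c hc h => ?_) (by simpa using isDyadic_zero)
        (by rw [hf.map_zero]; simpa using isDyadic_zero)
      exact hne ⟨c, Finset.mem_filter.2 ⟨hc, h.2⟩⟩

theorem IsThompson.one : IsThompson 1 :=
  ⟨fun _ _ h => h, ∅, by simp, fun _ _ _ _ => ⟨0, fun s _ t _ => by simp⟩⟩

theorem IsThompson.mul {g f : unitInterval ≃ₜ unitInterval} (hg : IsThompson g)
    (hf : IsThompson f) : IsThompson (g * f) := by
  classical
  obtain ⟨hgm, Bg, hBg, hlg⟩ := id hg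
  obtain ⟨hfm, Bf, hBf, hlf⟩ := id hf
  refine ⟨hgm.comp hfm, Bf ∪ Bg.image f.symm, ?_, ?_⟩
  · intro c hc
    rcases Finset.mem_union.1 hc with hc | hc
    · exact hBf c hc
    · obtain ⟨d, hd, rfl⟩ := Finset.mem_image.1 hc
      rw [← hf.isDyadic_iff, f.apply_symm_apply]
      exact hBg d hd
  · intro a b hab hc
    obtain ⟨k, hk⟩ := hlf a b hab fun c h => hc c (Finset.mem_union_left _ h)
    obtain ⟨l, hl⟩ := hlg (f a) (f b) (hfm.monotone hab) fun c h h' =>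
      hc (f.symm c) (Finset.mem_union_right _ (Finset.mem_image_of_mem _ h))
        ⟨hfm.lt_iff_lt.1 (by simpa using h'.1), hfm.lt_iff_lt.1 (by simpa using h'.2)⟩
    refine ⟨l + k, fun s hs t ht => ?_⟩
    have h := hl (f s) ⟨hfm.monotone hs.1, hfm.monotone hs.2⟩ (f t)
      ⟨hfm.monotone ht.1, hfm.monotone ht.2⟩
    rw [hk s hs t ht, ← mul_assoc, ← zpow_add₀ (by norm_num)] at h
    exact h

theorem IsThompson.inv {f : unitInterval ≃ₜ unitInterval} (hf : IsThompson f) :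
    IsThompson f⁻¹ := by
  classical
  obtain ⟨hfm, B, hB, hl⟩ := id hf
  have hm : StrictMono f.symm := fun a b hab => hfm.lt_iff_lt.1 (by simpa using hab)
  refine ⟨hm, B.image f, ?_, ?_⟩
  · intro c hc
    obtain ⟨d, hd, rfl⟩ := Finset.mem_image.1 hc
    exact (hf.isDyadic_iff d).2 (hB d hd)
  · intro a b hab hc
    obtain ⟨k, hk⟩ := hl (f.symm a) (f.symm b) (hm.monotone hab) fun c h h' =>
      hc (f c) (Finset.mem_image_of_mem _ h)
        ⟨hm.lt_iff_lt.1 (by simpa using h'.1), hm.lt_iff_lt.1 (by simpa using h'.2)⟩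
    refine ⟨-k, fun s hs t ht => ?_⟩
    have h := hk (f.symm s) ⟨hm.monotone hs.1, hm.monotone hs.2⟩ (f.symm t)
      ⟨hm.monotone ht.1, hm.monotone ht.2⟩
    rw [f.apply_symm_apply, f.apply_symm_apply] at h
    rw [h, ← mul_assoc, ← zpow_add₀ (by norm_num)]
    simp

/-- Thompson's group `F`. -/
def thompsonF : Subgroup (unitInterval ≃ₜ unitInterval) where
  carrier := {f | IsThompson f}
  one_mem' := IsThompson.one
  mul_mem' := IsThompson.mul
  inv_mem' := IsThompson.inv

/-- The natural action of `F` on `[0,1]`. -/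
instance : MulAction thompsonF unitInterval where
  smul f t := f.1 t
  one_smul _ := rfl
  mul_smul _ _ _ := rfl

/-! ### The standard generators -/

/-- The generator `x₀` as a function of a real variable. -/
def x0Fun (t : ℝ) : ℝ := if t ≤ 1 / 2 then t / 2 else if t ≤ 3 / 4 then t - 1 / 4 else 2 * t - 1

/-- The generator `x₁` as a function of a real variable. -/
def x1Fun (t : ℝ) : ℝ :=
  if t ≤ 1 / 2 then t else if t ≤ 3 / 4 then t / 2 + 1 / 4
  else if t ≤ 7 / 8 then t - 1 / 8 else 2 * t - 1

/-- The inverse of `x0Fun`. -/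
def x0Inv (t : ℝ) : ℝ :=
  if t ≤ 1 / 4 then 2 * t else if t ≤ 1 / 2 then t + 1 / 4 else t / 2 + 1 / 2

/-- The inverse of `x1Fun`. -/
def x1Inv (t : ℝ) : ℝ :=
  if t ≤ 1 / 2 then t else if t ≤ 5 / 8 then 2 * t - 1 / 2
  else if t ≤ 3 / 4 then t + 1 / 8 else t / 2 + 1 / 2

/-- The homeomorphism `x₀` of `[0,1]`. -/
def x0Homeo : unitInterval ≃ₜ unitInterval :=
  (StrictMono.orderIsoOfRightInverse
    (fun t : unitInterval => (⟨x0Fun t, by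
      have := t.2.1; have := t.2.2; unfold x0Fun; constructor <;> split_ifs <;> linarith⟩ :
        unitInterval))
    (by
      intro s t h
      have h' : (s : ℝ) < t := h
      change x0Fun s < x0Fun t
      unfold x0Fun
      split_ifs <;> linarith)
    (fun t : unitInterval => (⟨x0Inv t, by
      have := t.2.1; have := t.2.2; unfold x0Inv; constructor <;> split_ifs <;> linarith⟩ :
        unitInterval))
    (by
      intro t
      apply Subtype.ext
      change x0Fun (x0Inv t) = t
      unfold x0Fun x0Inv
      split_ifs <;> linarith)).toHomeomorph

/-- The homeomorphism `x₁` of `[0,1]`. -/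
def x1Homeo : unitInterval ≃ₜ unitInterval :=
  (StrictMono.orderIsoOfRightInverse
    (fun t : unitInterval => (⟨x1Fun t, by
      have := t.2.1; have := t.2.2; unfold x1Fun; constructor <;> split_ifs <;> linarith⟩ :
        unitInterval))
    (by
      intro s t h
      have h' : (s : ℝ) < t := h
      change x1Fun s < x1Fun t
      unfold x1Fun
      split_ifs <;> linarith)
    (fun t : unitInterval => (⟨x1Inv t, by
      have := t.2.1; have := t.2.2; unfold x1Inv; constructor <;> split_ifs <;> linarith⟩ :
        unitInterval))
    (by
      intro t
      apply Subtype.ext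
      change x1Fun (x1Inv t) = t
      unfold x1Fun x1Inv
      split_ifs <;> linarith)).toHomeomorph

theorem coe_x0Homeo (t : unitInterval) : (x0Homeo t : ℝ) = x0Fun t := rfl

theorem coe_x1Homeo (t : unitInterval) : (x1Homeo t : ℝ) = x1Fun t := rfl

theorem isThompson_x0 : IsThompson x0Homeo := by
  classical
  refine ⟨OrderIso.strictMono _, {⟨1 / 2, by constructor <;> norm_num⟩,
    ⟨3 / 4, by constructor <;> norm_num⟩}, ?_, ?_⟩
  · intro c hc
    simp only [Finset.mem_insert, Finset.mem_singleton] at hc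
    rcases hc with rfl | rfl
    · exact ⟨1, 1, by norm_num⟩
    · exact ⟨3, 2, by norm_num⟩
  · intro a b hab hc
    simp only [Finset.mem_insert, Finset.mem_singleton, forall_eq_or_imp, forall_eq,
      ← Subtype.coe_lt_coe, not_and_or, not_lt] at hc
    simp only [Set.mem_Icc, ← Subtype.coe_le_coe, coe_x0Homeo, x0Fun]
    obtain ⟨h1, h2⟩ := hc
    rcases h1 with h1 | h1
    · rcases h2 with h2 | h2
      · exact ⟨1, fun s hs t ht => by rw [zpow_one]; split_ifs <;> linarith [hs.1, ht.1]⟩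
      · exact ⟨0, fun s hs t ht => by
          rw [zpow_zero]; split_ifs <;> linarith [hs.1, ht.1, hs.2, ht.2]⟩
    · exact ⟨-1, fun s hs t ht => by rw [zpow_neg_one]; split_ifs <;> linarith [hs.2, ht.2]⟩

theorem isThompson_x1 : IsThompson x1Homeo := by
  classical
  refine ⟨OrderIso.strictMono _, {⟨1 / 2, by constructor <;> norm_num⟩,
    ⟨3 / 4, by constructor <;> norm_num⟩, ⟨7 / 8, by constructor <;> norm_num⟩}, ?_, ?_⟩
  · intro c hc
    simp only [Finset.mem_insert, Finset.mem_singleton] at hc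
    rcases hc with rfl | rfl | rfl
    · exact ⟨1, 1, by norm_num⟩
    · exact ⟨3, 2, by norm_num⟩
    · exact ⟨7, 3, by norm_num⟩
  · intro a b hab hc
    simp only [Finset.mem_insert, Finset.mem_singleton, forall_eq_or_imp, forall_eq,
      ← Subtype.coe_lt_coe, not_and_or, not_lt] at hc
    simp only [Set.mem_Icc, ← Subtype.coe_le_coe, coe_x1Homeo, x1Fun]
    obtain ⟨h1, h2, h3⟩ := hc
    rcases h1 with h1 | h1
    · rcases h2 with h2 | h2
      · rcases h3 with h3 | h3
        · exact ⟨1, fun s hs t ht => by rw [zpow_one]; split_ifs <;> linarith [hs.1, ht.1]⟩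
        · exact ⟨0, fun s hs t ht => by
            rw [zpow_zero]; split_ifs <;> linarith [hs.1, ht.1, hs.2, ht.2]⟩
      · exact ⟨-1, fun s hs t ht => by
          rw [zpow_neg_one]; split_ifs <;> linarith [hs.1, ht.1, hs.2, ht.2]⟩
    · exact ⟨0, fun s hs t ht => by rw [zpow_zero]; split_ifs <;> linarith [hs.2, ht.2]⟩

/-- The generator `x₀` of `F`. -/
def genX0 : thompsonF := ⟨x0Homeo, isThompson_x0⟩

/-- The generator `x₁` of `F`. -/
def genX1 : thompsonF := ⟨x1Homeo, isThompson_x1⟩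

/-! ## Labelled directed graphs and their automorphisms -/

/-- A directed graph (loops and multiple arrows allowed) with vertex set `V`, set of arrows `E`,
and arrows labelled by `L`. -/
structure LabelledDigraph (V E L : Type*) where
  src : E → V
  tgt : E → V
  label : E → L

namespace LabelledDigraph

/-- The unordered pair of end points of an arrow; forgetting labels and directions, the graph
becomes the undirected multigraph with vertices `V`, edges `E` and these end points. -/
def endpoints {V E L : Type*} (Γ : LabelledDigraph V E L) (e : E) : Sym2 V :=
  s(Γ.src e, Γ.tgt e)

/-- The automorphism group of the marked graph: the permutations of the vertices that are
induced by an automorphism, i.e. that come with a permutation of the arrows respecting sources,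
targets and labels. -/
def markedAut {V E L : Type*} (Γ : LabelledDigraph V E L) : Subgroup (Equiv.Perm V) where
  carrier := {σ | ∃ τ : Equiv.Perm E, ∀ e, Γ.src (τ e) = σ (Γ.src e) ∧
    Γ.tgt (τ e) = σ (Γ.tgt e) ∧ Γ.label (τ e) = Γ.label e}
  one_mem' := ⟨1, by simp⟩
  mul_mem' := by
    rintro σ σ' ⟨τ, h⟩ ⟨τ', h'⟩
    exact ⟨τ * τ', fun e => by simp [h, h']⟩
  inv_mem' := by
    rintro σ ⟨τ, h⟩
    refine ⟨τ⁻¹, fun e => ?_⟩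
    have := h (τ.symm e)
    simp only [Equiv.apply_symm_apply] at this
    simp [this]

/-- The automorphism group of the underlying undirected multigraph (labels and directions
forgotten): the permutations of the vertices that are induced by an automorphism, i.e. that come
with a permutation of the edges respecting the unordered pairs of end points. -/
def unmarkedAut {V E L : Type*} (Γ : LabelledDigraph V E L) : Subgroup (Equiv.Perm V) where
  carrier := {σ | ∃ τ : Equiv.Perm E, ∀ e, Γ.endpoints (τ e) = (Γ.endpoints e).map σ}
  one_mem' := ⟨1, by simp⟩
  mul_mem' := by
    rintro σ σ' ⟨τ, h⟩ ⟨τ', h'⟩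
    exact ⟨τ * τ', fun e => by simp [h, h', Sym2.map_map]⟩
  inv_mem' := by
    rintro σ ⟨τ, h⟩
    refine ⟨τ⁻¹, fun e => ?_⟩
    have := h (τ.symm e)
    simp only [Equiv.apply_symm_apply] at this
    simp [this, Sym2.map_map]

end LabelledDigraph

/-! ## Schreier graphs -/

/-- The orbital Schreier graph of an action of `G` on `M` with respect to the elements `s i`:
the vertices are the points of `M`, and for every `m` and `i` there is one arrow, labelled `i`,
from `m` to the image of `m` under `s i`. -/
def schreierGraph {G M ι : Type*} [Group G] [MulAction G M] (s : ι → G) :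
    LabelledDigraph M (M × ι) ι where
  src e := e.1
  tgt e := s e.2 • e.1
  label e := e.2

/-- The Schreier graph `Γ_x` of the action of Thompson's group `F` on the orbit of `x ∈ [0,1]`
with respect to the generators `x₀` and `x₁`. -/
def thompsonSchreier (x : unitInterval) :
    LabelledDigraph (MulAction.orbit thompsonF x) (MulAction.orbit thompsonF x × Fin 2) (Fin 2) :=
  schreierGraph ![genX0, genX1]

end

/-!
In `(0, 1)` the loops of the graph are exactly those at the points of `(0, 1/2]`. A point beyond
`1/2` has a neighbour in `(0, 1/2]` if and only if it lies in `(1/2, 3/4]`, so an automorphism `σ`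
of the undirected graph preserves the three regions `(0, 1/2]`, `(1/2, 3/4]` and `(3/4, 1)`.

Parametrize the middle region by `(0, 1]`. Its edges join `u` to `u / 2`, via `x₁`, and its paths
of length two through `(3/4, 1)` join `u` to `(u + 1) / 2`, via `x₁ x₀⁻¹`, or back to `u`. Each of
these two graphs is a union of rays and of fixed points, and whether a point is the initial vertex
of a ray can be read off its number of neighbours in the middle region. Hence `σ` commutes with
both maps. Every point is in the image of one of them and both halve distances, so the displacement
of `σ` is bounded by `2⁻ⁿ` for every `n`, and `σ` fixes the middle region.

The remaining vertices form the rays of `x₀` in `(0, 1/2]` and of `x₀⁻¹` in `(3/4, 1)`, whose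
initial vertices are determined by their neighbours in the middle region.
-/

section Rays

variable {V : Type*}

theorem eq_zero_of_norm_le_mul {E : Type*} [NormedAddGroup E] {Q : Set V} {d : V → E} {C k : ℝ}
    (hk₀ : 0 ≤ k) (hk₁ : k < 1) (hC : ∀ v ∈ Q, ‖d v‖ ≤ C)
    (hd : ∀ v ∈ Q, ∃ w ∈ Q, ‖d v‖ ≤ k * ‖d w‖) : ∀ v ∈ Q, d v = 0 := by
  have bound (n : ℕ) : ∀ v ∈ Q, ‖d v‖ ≤ k ^ n * C := by
    induction n with
    | zero => simpa using hC
    | succ n ih =>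
      intro v hv
      obtain ⟨w, hw, hvw⟩ := hd v hv
      calc ‖d v‖ ≤ k * ‖d w‖ := hvw
        _ ≤ k * (k ^ n * C) := by gcongr; exact ih w hw
        _ = k ^ (n + 1) * C := by ring
  have lim : Filter.Tendsto (fun n : ℕ => k ^ n * C) Filter.atTop (nhds 0) := by
    simpa using (tendsto_pow_atTop_nhds_zero_of_lt_one hk₀ hk₁).mul_const C
  exact fun v hv => norm_le_zero_iff.1 (ge_of_tendsto' lim fun n => bound n v hv)

theorem eq_or_exists_iterate_eq_of_norm_le_mul {X : Type*} [NormedAddGroup X] {φ : V → V}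
    {Q : Set V} {c : V → X} (hc : Function.Injective c) {p : X} {C k : ℝ} (hk₀ : 0 ≤ k)
    (hk₁ : k < 1) (hC : ∀ u ∈ Q, ‖c u - p‖ ≤ C) (hφ : ∀ u ∈ Q, ‖c (φ u) - p‖ ≤ k * ‖c u - p‖)
    {u : V} (hu : u ∈ Q) : φ u = u ∨ ∃ v ∈ Q \ φ '' Q, ∃ n, φ^[n] v = u := by
  by_contra! ⟨hφu, hnot⟩
  have hup : c u ≠ p := by
    rintro rfl
    exact hφu (hc (sub_eq_zero.1 (norm_le_zero_iff.1 (by simpa using hφ u hu))))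
  let S : Set V := {u ∈ Q | ∀ v ∈ Q \ φ '' Q, ∀ n, φ^[n] v ≠ u}
  refine hup (sub_eq_zero.1 (eq_zero_of_norm_le_mul (Q := S) (d := fun u => c u - p) hk₀ hk₁
    (fun v hv => hC v hv.1) ?_ u ⟨hu, hnot⟩))
  rintro v ⟨hvQ, hv⟩
  obtain ⟨w, hw, rfl⟩ : v ∈ φ '' Q := by
    by_contra hvφ
    exact hv v ⟨hvQ, hvφ⟩ 0 rfl
  refine ⟨w, ⟨hw, fun v' hv' n hn => hv v' hv' (n + 1) ?_⟩, hφ w hw⟩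
  rw [Function.iterate_succ_apply', hn]

/-- The graph `R` restricted to `Q` is a disjoint union of rays `v, φ v, φ (φ v), …` issuing from
the points `v` of `Q \ φ '' Q`, and of isolated fixed points of `φ`; loops are allowed. -/
structure IsRayBundle (R : V → V → Prop) (φ : V → V) (Q : Set V) : Prop where
  injective : Function.Injective φ
  mapsTo : Set.MapsTo φ Q Q
  rel_map : ∀ u ∈ Q, R u (φ u)
  eq_of_rel : ∀ u ∈ Q, ∀ w ∈ Q, R u w → w = u ∨ w = φ u ∨ φ w = u
  eq_or_exists_iterate_eq : ∀ u ∈ Q, φ u = u ∨ ∃ v ∈ Q \ φ '' Q, ∃ n, φ^[n] v = u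

namespace IsRayBundle

variable {R : V → V → Prop} {φ : V → V} {Q : Set V}

theorem iterate_injective (h : IsRayBundle R φ Q) {v : V} (hv : v ∈ Q \ φ '' Q) :
    Function.Injective fun n => φ^[n] v := by
  have not_lt {m n : ℕ} (hmn : m < n) : φ^[m] v ≠ φ^[n] v := by
    obtain ⟨k, rfl⟩ := Nat.exists_eq_add_of_lt hmn
    intro heq
    have hcycle : φ^[k + 1] v = v := (h.injective.iterate m <| by
      rwa [← Function.iterate_add_apply, ← add_assoc]).symm
    exact hv.2 ⟨φ^[k] v, h.mapsTo.iterate k hv.1,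
      (Function.iterate_succ_apply' φ k v).symm.trans hcycle⟩
  intro m n hmn
  by_contra hne
  exact (Nat.lt_or_gt_of_ne hne).elim (not_lt · hmn) (not_lt · hmn.symm)

theorem exists_le_succ_of_rel_iterate (h : IsRayBundle R φ Q) {v w : V} (hv : v ∈ Q \ φ '' Q)
    (hw : w ∈ Q) {n : ℕ} (hvw : R (φ^[n] v) w) : ∃ k ≤ n + 1, w = φ^[k] v := by
  rcases h.eq_of_rel _ (h.mapsTo.iterate n hv.1) w hw hvw with hself | hsucc | hpred
  · exact ⟨n, n.le_succ, hself⟩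
  · exact ⟨n + 1, le_rfl, by rw [hsucc, Function.iterate_succ_apply']⟩
  · cases n with
    | zero => exact absurd ⟨w, hw, hpred⟩ hv.2
    | succ n =>
      rw [Function.iterate_succ_apply'] at hpred
      exact ⟨n, by lia, h.injective hpred⟩

variable {σ : Equiv.Perm V}

theorem map_iterate (h : IsRayBundle R φ Q) (hR : ∀ u w, R u w → R (σ u) (σ w))
    (hQ : Set.MapsTo σ Q Q) {v : V} (hv : v ∈ Q \ φ '' Q) (hσv : σ v ∈ Q \ φ '' Q) (n : ℕ) :
    σ (φ^[n] v) = φ^[n] (σ v) := by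
  induction n using Nat.strong_induction_on with
  | _ n ih =>
    cases n with
    | zero => rfl
    | succ n =>
      have hmem := h.mapsTo.iterate n hv.1
      have hrel : R (φ^[n] (σ v)) (σ (φ^[n + 1] v)) := by
        rw [← ih n n.lt_succ_self, Function.iterate_succ_apply']
        exact hR _ _ (h.rel_map _ hmem)
      obtain ⟨k, hk, heq⟩ :=
        h.exists_le_succ_of_rel_iterate hσv (hQ (h.mapsTo.iterate (n + 1) hv.1)) hrel
      obtain hlt | rfl := hk.lt_or_eq
      · rw [← ih k hlt] at heq
        exact absurd (h.iterate_injective hv (σ.injective heq)) hlt.ne'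
      · exact heq

theorem map_comm (h : IsRayBundle R φ Q) (hR : ∀ u w, R (σ u) (σ w) ↔ R u w)
    (hQ : ∀ u, σ u ∈ Q ↔ u ∈ Q) (hroot : Set.MapsTo σ (Q \ φ '' Q) (Q \ φ '' Q)) {u : V}
    (hu : u ∈ Q) : σ (φ u) = φ (σ u) := by
  have hmap {v : V} (hv : v ∈ Q \ φ '' Q) (n : ℕ) : σ (φ^[n] v) = φ^[n] (σ v) :=
    h.map_iterate (fun _ _ => (hR _ _).2) (fun _ => (hQ _).2) hv (hroot hv) n
  obtain hfix | ⟨v, hv, n, rfl⟩ := h.eq_or_exists_iterate_eq u hu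
  · obtain ⟨w, hw⟩ := σ.surjective (φ (σ u))
    have hσu := (hQ u).2 hu
    have hrel : R u w := by rw [← hR, hw]; exact h.rel_map _ hσu
    have hwQ : w ∈ Q := by rw [← hQ, hw]; exact h.mapsTo hσu
    have hwu : w = u := by
      rcases h.eq_of_rel u hu w hwQ hrel with hself | hsucc | hpred
      · exact hself
      · exact hsucc.trans hfix
      · exact h.injective (hpred.trans hfix.symm)
    rw [hfix, ← hw, hwu]
  · rw [hmap hv, ← Function.iterate_succ_apply' φ, ← Function.iterate_succ_apply' φ, hmap hv]

theorem map_eq_self (h : IsRayBundle R φ Q) (hR : ∀ u w, R u w → R (σ u) (σ w))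
    (hQ : Set.MapsTo σ Q Q) (hroot : ∀ v ∈ Q \ φ '' Q, σ v = v) {u : V} (hu : u ∈ Q)
    (hφu : φ u ≠ u) : σ u = u := by
  obtain ⟨v, hv, n, rfl⟩ := (h.eq_or_exists_iterate_eq u hu).resolve_left hφu
  rw [h.map_iterate hR hQ hv ((hroot v hv).symm ▸ hv), hroot v hv]

end IsRayBundle

end Rays

section Coordinates

theorem x0Inv_x0Fun (t : ℝ) : x0Inv (x0Fun t) = t := by grind [x0Inv, x0Fun]

theorem x1Inv_x1Fun (t : ℝ) : x1Inv (x1Fun t) = t := by grind [x1Inv, x1Fun]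

variable {V : Type*} [MulAction thompsonF V] (c : V →[thompsonF] unitInterval)

theorem coe_genX0_smul (v : V) : (c (genX0 • v) : ℝ) = x0Fun (c v) := by
  rw [map_smul]; rfl

theorem coe_genX1_smul (v : V) : (c (genX1 • v) : ℝ) = x1Fun (c v) := by
  rw [map_smul]; rfl

theorem coe_genX0_inv_smul (v : V) : (c (genX0⁻¹ • v) : ℝ) = x0Inv (c v) := by
  rw [← x0Inv_x0Fun (c (genX0⁻¹ • v)), ← coe_genX0_smul, smul_inv_smul]

theorem coe_genX1_inv_smul (v : V) : (c (genX1⁻¹ • v) : ℝ) = x1Inv (c v) := by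
  rw [← x1Inv_x1Fun (c (genX1⁻¹ • v)), ← coe_genX1_smul, smul_inv_smul]

end Coordinates

/-- Adjacency of two points of the line under `x0Fun` or `x1Fun`, in either direction. -/
def ThompsonAdj (y z : ℝ) : Prop := z = x0Fun y ∨ y = x0Fun z ∨ z = x1Fun y ∨ y = x1Fun z

namespace ThompsonAdj

variable {y z : ℝ}

theorem self_iff (hy : y ∈ Set.Ioo 0 1) : ThompsonAdj y y ↔ y ≤ 1 / 2 := by
  grind [ThompsonAdj, x0Fun, x1Fun]

theorem low_low (h : ThompsonAdj y z) (hy : y ≤ 1 / 2) (hz : z ≤ 1 / 2) :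
    z = y ∨ z = y / 2 ∨ z = 2 * y := by
  grind [ThompsonAdj, x0Fun, x1Fun]

theorem of_low (h : ThompsonAdj y z) (hy : y ≤ 1 / 2) (hz : 1 / 2 < z) :
    z ≤ 3 / 4 ∧ y = z - 1 / 4 := by
  grind [ThompsonAdj, x0Fun, x1Fun]

theorem mid_mid (h : ThompsonAdj y z) (hy : y ∈ Set.Ioc (1 / 2) (3 / 4))
    (hz : z ∈ Set.Ioc (1 / 2) (3 / 4)) : z = y / 2 + 1 / 4 ∨ y = z / 2 + 1 / 4 := by
  grind [ThompsonAdj, x0Fun, x1Fun]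

theorem mid_high (h : ThompsonAdj y z) (hy : y ∈ Set.Ioc (1 / 2) (3 / 4)) (hz : 3 / 4 < z) :
    z = y / 2 + 1 / 2 ∨ z = y + 1 / 8 := by
  grind [ThompsonAdj, x0Fun, x1Fun]

theorem high_high (h : ThompsonAdj y z) (hy : 3 / 4 < y) (hz : 3 / 4 < z) :
    z = y / 2 + 1 / 2 ∨ y = z / 2 + 1 / 2 := by
  grind [ThompsonAdj, x0Fun, x1Fun]

end ThompsonAdj

namespace LabelledDigraph

variable {V E L : Type*} (Γ : LabelledDigraph V E L)

/-- Adjacency in the underlying simple graph with loops: two vertices are adjacent if they are the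
end points of some arrow, in either direction. -/
def Adj (u v : V) : Prop := ∃ e, Γ.endpoints e = s(u, v)

variable {Γ}

theorem Adj.symm {u v : V} (h : Γ.Adj u v) : Γ.Adj v u :=
  h.imp fun _ he => he.trans Sym2.eq_swap

theorem adj_map_of_mem_unmarkedAut {σ : Equiv.Perm V} (hσ : σ ∈ Γ.unmarkedAut) {u v : V}
    (h : Γ.Adj u v) : Γ.Adj (σ u) (σ v) := by
  obtain ⟨τ, hτ⟩ := hσ
  obtain ⟨e, he⟩ := h
  exact ⟨τ e, by rw [hτ, he, Sym2.map_mk]⟩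

theorem adj_map_iff_of_mem_unmarkedAut {σ : Equiv.Perm V} (hσ : σ ∈ Γ.unmarkedAut) (u v : V) :
    Γ.Adj (σ u) (σ v) ↔ Γ.Adj u v :=
  ⟨fun h => by simpa using adj_map_of_mem_unmarkedAut (inv_mem hσ) h,
    adj_map_of_mem_unmarkedAut hσ⟩

variable (Γ) in
theorem markedAut_le_unmarkedAut : Γ.markedAut ≤ Γ.unmarkedAut := by
  rintro σ ⟨τ, hτ⟩
  exact ⟨τ, fun e => by simp only [endpoints, hτ, Sym2.map_mk]⟩

end LabelledDigraph

theorem schreierGraph_adj_iff {G M ι : Type*} [Group G] [MulAction G M] {s : ι → G} {u v : M} :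
    (schreierGraph s).Adj u v ↔ ∃ i, s i • u = v ∨ s i • v = u := by
  simp only [LabelledDigraph.Adj, LabelledDigraph.endpoints, schreierGraph, Prod.exists,
    Sym2.eq_iff]
  grind

section ThompsonGraph

variable {V : Type*} [MulAction thompsonF V]

variable (V) in
/-- The Schreier graph of an arbitrary `F`-set with respect to the standard generators. -/
noncomputable abbrev thompsonGraph : LabelledDigraph V (V × Fin 2) (Fin 2) :=
  schreierGraph ![genX0, genX1]

variable {c : V →[thompsonF] unitInterval}

theorem thompsonGraph_adj_iff (hc : Function.Injective c) {u v : V} :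
    (thompsonGraph V).Adj u v ↔ ThompsonAdj (c u) (c v) := by
  have coord_eq (w w' : V) : w = w' ↔ (c w : ℝ) = c w' := by rw [Subtype.coe_inj, hc.eq_iff]
  simp only [schreierGraph_adj_iff, ThompsonAdj, Fin.exists_fin_two, Matrix.cons_val_zero,
    Matrix.cons_val_one, coord_eq, coe_genX0_smul, coe_genX1_smul]
  grind

theorem thompsonGraph_adj_genX0_smul (v : V) : (thompsonGraph V).Adj v (genX0 • v) :=
  ⟨(v, 0), rfl⟩

theorem thompsonGraph_adj_genX0_inv_smul (v : V) : (thompsonGraph V).Adj v (genX0⁻¹ • v) :=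
  .symm ⟨(genX0⁻¹ • v, 0), congrArg (s(genX0⁻¹ • v, ·)) (smul_inv_smul genX0 v)⟩

theorem thompsonGraph_adj_genX1_smul (v : V) : (thompsonGraph V).Adj v (genX1 • v) :=
  ⟨(v, 1), rfl⟩

namespace thompsonGraph

variable (c)

/-- The part of an `F`-set in the interval on which `x₁` is the identity. -/
def low : Set V := {v | (c v : ℝ) ≤ 1 / 2}

/-- The part of an `F`-set in the interval `(1/2, 3/4]`, a fundamental domain of `x₀`. -/
def mid : Set V := {v | (c v : ℝ) ∈ Set.Ioc (1 / 2) (3 / 4)}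

/-- The part of an `F`-set in the interval `(3/4, 1]`. -/
def high : Set V := {v | 3 / 4 < (c v : ℝ)}

/-- Being joined by a path of length two through a point of `high c`; on `mid c` this relation
encodes the action of `x₁ x₀⁻¹`. -/
def HighLink (u w : V) : Prop :=
  ∃ h ∈ high c, (thompsonGraph V).Adj u h ∧ (thompsonGraph V).Adj h w

variable {c}

section Mid

variable {u : V}

theorem coe_genX0_inv_smul_of_mem_mid (hu : u ∈ mid c) :
    (c (genX0⁻¹ • u) : ℝ) = (c u + 1) / 2 := by
  have := coe_genX0_inv_smul c u
  grind [mid, x0Inv]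

theorem genX0_inv_smul_mem_high (hu : u ∈ mid c) : genX0⁻¹ • u ∈ high c := by
  have := coe_genX0_inv_smul_of_mem_mid hu
  grind [mid, high]

theorem coe_genX1_smul_of_mem_mid (hu : u ∈ mid c) :
    (c (genX1 • u) : ℝ) = (c u + 1 / 2) / 2 := by
  have := coe_genX1_smul c u
  grind [mid, x1Fun]

theorem coe_mul_smul_of_mem_mid (hu : u ∈ mid c) :
    (c ((genX1 * genX0⁻¹) • u) : ℝ) = (c u + 3 / 4) / 2 := by
  rw [mul_smul, coe_genX1_smul, coe_genX0_inv_smul_of_mem_mid hu]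
  grind [mid, x1Fun]

theorem genX1_smul_mem_mid (hu : u ∈ mid c) : genX1 • u ∈ mid c := by
  have := coe_genX1_smul_of_mem_mid hu
  grind [mid]

theorem mul_smul_mem_mid (hu : u ∈ mid c) : (genX1 * genX0⁻¹) • u ∈ mid c := by
  rw [mid, Set.mem_ofPred_eq, coe_mul_smul_of_mem_mid hu]
  grind [mid]

theorem highLink_mul_smul (hu : u ∈ mid c) : HighLink c u ((genX1 * genX0⁻¹) • u) := by
  refine ⟨genX0⁻¹ • u, genX0_inv_smul_mem_high hu, thompsonGraph_adj_genX0_inv_smul u, ?_⟩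
  rw [mul_smul]
  exact thompsonGraph_adj_genX1_smul (genX0⁻¹ • u)

theorem HighLink.coe_eq_or (hc : Function.Injective c) {w : V} (h : HighLink c u w)
    (hu : u ∈ mid c) (hw : w ∈ mid c) :
    (c w : ℝ) = c u ∨ (c w : ℝ) = (c u + 3 / 4) / 2 ∨ (c u : ℝ) = (c w + 3 / 4) / 2 := by
  obtain ⟨v, hv, huv, hvw⟩ := h
  have := ((thompsonGraph_adj_iff hc).1 huv).mid_high hu hv
  have := ((thompsonGraph_adj_iff hc).1 hvw.symm).mid_high hw hv
  grind

end Mid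

theorem coe_genX0_smul_of_mem_low {u : V} (hu : u ∈ low c) :
    (c (genX0 • u) : ℝ) = (c u + 0) / 2 := by
  have := coe_genX0_smul c u
  grind [low, x0Fun]

theorem coe_genX0_inv_smul_of_mem_high {u : V} (hu : u ∈ high c) :
    (c (genX0⁻¹ • u) : ℝ) = (c u + 1) / 2 := by
  have := coe_genX0_inv_smul c u
  grind [high, x0Inv]

theorem isRayBundle_smul {R : V → V → Prop} {g : thompsonF} {Q : Set V} {p : ℝ}
    (hc : Function.Injective c) (hp : p ∈ unitInterval) (hQ : ∀ u ∈ Q, g • u ∈ Q)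
    (hmid : ∀ u ∈ Q, (c (g • u) : ℝ) = (c u + p) / 2) (hR : ∀ u ∈ Q, R u (g • u))
    (hR' : ∀ u ∈ Q, ∀ w ∈ Q, R u w →
      (c w : ℝ) = c u ∨ (c w : ℝ) = (c u + p) / 2 ∨ (c u : ℝ) = (c w + p) / 2) :
    IsRayBundle R (g • ·) Q where
  injective := MulAction.injective g
  mapsTo := fun u hu => hQ u hu
  rel_map := hR
  eq_of_rel u hu w hw h := by
    have hc' := Subtype.val_injective.comp hc
    rcases hR' u hu w hw h with h | h | h
    · exact .inl (hc' h)
    · exact .inr (.inl (hc' (h.trans (hmid u hu).symm)))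
    · exact .inr (.inr (hc' ((hmid w hw).trans h.symm)))
  eq_or_exists_iterate_eq u hu := by
    refine eq_or_exists_iterate_eq_of_norm_le_mul (k := 1 / 2) (p := p) (C := 1)
      (Subtype.val_injective.comp hc) (by norm_num) (by norm_num) (fun v _ => ?_)
      (fun v hv => ?_) hu
    · rw [Real.norm_eq_abs, abs_le, Function.comp_apply]
      constructor <;> linarith [(c v).2.1, (c v).2.2, hp.1, hp.2]
    · have : (c (g • v) : ℝ) - p = 1 / 2 * (c v - p) := by rw [hmid v hv]; ring
      rw [Function.comp_apply, this, norm_mul]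
      norm_num

theorem isRayBundle_low (hc : Function.Injective c) :
    IsRayBundle (thompsonGraph V).Adj (genX0 • ·) (low c) := by
  refine isRayBundle_smul hc ⟨le_rfl, zero_le_one⟩ (fun u hu => ?_)
    (fun u hu => coe_genX0_smul_of_mem_low hu) (fun u _ => thompsonGraph_adj_genX0_smul u)
    fun u hu w hw h => ?_
  · have := coe_genX0_smul_of_mem_low hu
    have := (c u).2.1
    grind [low]
  · have := ((thompsonGraph_adj_iff hc).1 h).low_low hu hw
    grind

theorem isRayBundle_high (hc : Function.Injective c) :
    IsRayBundle (thompsonGraph V).Adj (genX0⁻¹ • ·) (high c) := by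
  refine isRayBundle_smul hc ⟨zero_le_one, le_rfl⟩ (fun u hu => ?_)
    (fun u hu => coe_genX0_inv_smul_of_mem_high hu)
    (fun u _ => thompsonGraph_adj_genX0_inv_smul u) fun u hu w hw h => ?_
  · have := coe_genX0_inv_smul_of_mem_high hu
    grind [high]
  · have := ((thompsonGraph_adj_iff hc).1 h).high_high hu hw
    grind

theorem isRayBundle_mid_adj (hc : Function.Injective c) :
    IsRayBundle (thompsonGraph V).Adj (genX1 • ·) (mid c) := by
  refine isRayBundle_smul hc (by constructor <;> norm_num) (fun _ => genX1_smul_mem_mid)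
    (fun _ => coe_genX1_smul_of_mem_mid) (fun u _ => thompsonGraph_adj_genX1_smul u)
    fun u hu w hw h => ?_
  have := ((thompsonGraph_adj_iff hc).1 h).mid_mid hu hw
  grind

theorem isRayBundle_mid_highLink (hc : Function.Injective c) :
    IsRayBundle (HighLink c) ((genX1 * genX0⁻¹) • ·) (mid c) :=
  isRayBundle_smul hc (by constructor <;> norm_num) (fun _ => mul_smul_mem_mid)
    (fun _ => coe_mul_smul_of_mem_mid) (fun _ => highLink_mul_smul)
    fun _ hu _ hw h => h.coe_eq_or hc hu hw

section Images

variable {v : V}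

theorem mem_image_genX1_smul_iff (hv : v ∈ mid c) :
    v ∈ (genX1 • · : V → V) '' mid c ↔ (c v : ℝ) ≤ 5 / 8 := by
  constructor
  · rintro ⟨u, hu, rfl⟩
    have := coe_genX1_smul_of_mem_mid hu
    grind [mid]
  · intro h
    refine ⟨genX1⁻¹ • v, ?_, smul_inv_smul genX1 v⟩
    have := coe_genX1_inv_smul c v
    grind [mid, x1Inv]

theorem mem_image_mul_smul_iff (hv : v ∈ mid c) :
    v ∈ ((genX1 * genX0⁻¹) • · : V → V) '' mid c ↔ 5 / 8 < (c v : ℝ) := by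
  constructor
  · rintro ⟨u, hu, rfl⟩
    rw [coe_mul_smul_of_mem_mid hu]
    grind [mid]
  · intro h
    refine ⟨(genX1 * genX0⁻¹)⁻¹ • v, ?_, smul_inv_smul (genX1 * genX0⁻¹) v⟩
    have hx₁ := coe_genX1_inv_smul c v
    rw [mid, Set.mem_ofPred_eq, mul_inv_rev, inv_inv, mul_smul, coe_genX0_smul, hx₁]
    grind [mid, x0Fun, x1Inv]

theorem lt_coe_of_mem_low_diff_image (hv : v ∈ low c \ (genX0 • ·) '' low c) :
    1 / 4 < (c v : ℝ) := by
  by_contra! h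
  refine hv.2 ⟨genX0⁻¹ • v, ?_, smul_inv_smul genX0 v⟩
  have := coe_genX0_inv_smul c v
  grind [low, x0Inv]

theorem coe_le_of_mem_high_diff_image (hv : v ∈ high c \ (genX0⁻¹ • ·) '' high c) :
    (c v : ℝ) ≤ 7 / 8 := by
  by_contra! h
  refine hv.2 ⟨genX0 • v, ?_, inv_smul_smul genX0 v⟩
  have := coe_genX0_smul c v
  grind [high, x0Fun]

end Images

section Definability

variable {v : V}

theorem mem_low_iff (hc : Function.Injective c) (h01 : ∀ v, (c v : ℝ) ∈ Set.Ioo 0 1) :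
    v ∈ low c ↔ (thompsonGraph V).Adj v v := by
  rw [thompsonGraph_adj_iff hc, ThompsonAdj.self_iff (h01 v)]
  rfl

theorem mem_mid_iff (hc : Function.Injective c) :
    v ∈ mid c ↔ v ∉ low c ∧ ∃ w ∈ low c, (thompsonGraph V).Adj w v := by
  constructor
  · intro hv
    refine ⟨by grind [low, mid], genX0 • v, ?_, (thompsonGraph_adj_genX0_smul v).symm⟩
    have := coe_genX0_smul c v
    grind [low, mid, x0Fun]
  · rintro ⟨hv, w, hw, hwv⟩
    have hlt : 1 / 2 < (c v : ℝ) := not_le.1 hv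
    exact ⟨hlt, (((thompsonGraph_adj_iff hc).1 hwv).of_low hw hlt).1⟩

theorem mem_high_iff : v ∈ high c ↔ v ∉ low c ∧ v ∉ mid c := by
  grind [low, mid, high]

theorem coe_le_five_eighths_iff (hc : Function.Injective c) (hv : v ∈ mid c) :
    (c v : ℝ) ≤ 5 / 8 ↔ ∃ w w', w ≠ w' ∧
      (w ∈ mid c ∧ (thompsonGraph V).Adj v w) ∧ w' ∈ mid c ∧ (thompsonGraph V).Adj v w' := by
  constructor
  · intro h
    obtain ⟨u, hu, rfl⟩ := (mem_image_genX1_smul_iff hv).2 h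
    refine ⟨genX1 • genX1 • u, u, fun heq => ?_,
      ⟨genX1_smul_mem_mid hv, thompsonGraph_adj_genX1_smul (genX1 • u)⟩,
      hu, (thompsonGraph_adj_genX1_smul u).symm⟩
    have h₁ := coe_genX1_smul_of_mem_mid hu
    have h₂ := coe_genX1_smul_of_mem_mid hv
    rw [heq] at h₂
    grind [mid]
  · rintro ⟨w, w', hne, ⟨hw, hvw⟩, hw', hvw'⟩
    have := ((thompsonGraph_adj_iff hc).1 hvw).mid_mid hv hw
    have := ((thompsonGraph_adj_iff hc).1 hvw').mid_mid hv hw'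
    have := (Subtype.val_injective.comp hc).ne hne
    grind [mid]

end Definability

section Automorphism

variable (hc : Function.Injective c) (h01 : ∀ v, (c v : ℝ) ∈ Set.Ioo 0 1)
  (σ : (thompsonGraph V).Adj ≃r (thompsonGraph V).Adj) {u v w : V}

include hc h01

theorem map_mem_low_iff : σ v ∈ low c ↔ v ∈ low c := by
  rw [mem_low_iff hc h01, mem_low_iff hc h01, σ.map_rel_iff]

theorem map_mem_mid_iff : σ v ∈ mid c ↔ v ∈ mid c := by
  rw [mem_mid_iff hc, mem_mid_iff hc, σ.surjective.exists]
  simp only [map_mem_low_iff hc h01, σ.map_rel_iff]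

theorem map_mem_high_iff : σ v ∈ high c ↔ v ∈ high c := by
  simp only [mem_high_iff, map_mem_low_iff hc h01, map_mem_mid_iff hc h01]

theorem highLink_map_iff : HighLink c (σ u) (σ w) ↔ HighLink c u w := by
  rw [HighLink, HighLink, σ.surjective.exists]
  simp only [map_mem_high_iff hc h01, σ.map_rel_iff]

theorem coe_map_le_five_eighths_iff (hv : v ∈ mid c) :
    (c (σ v) : ℝ) ≤ 5 / 8 ↔ (c v : ℝ) ≤ 5 / 8 := by
  rw [coe_le_five_eighths_iff hc hv,
    coe_le_five_eighths_iff hc ((map_mem_mid_iff hc h01 σ).2 hv), σ.surjective.exists₂]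
  simp only [map_mem_mid_iff hc h01, σ.map_rel_iff, σ.injective.ne_iff]

theorem map_genX1_smul_of_mem_mid (hu : u ∈ mid c) : σ (genX1 • u) = genX1 • σ u := by
  refine (isRayBundle_mid_adj hc).map_comm (σ := σ.toEquiv) (fun _ _ => σ.map_rel_iff)
    (fun _ => map_mem_mid_iff hc h01 σ) (fun v ⟨hv, hroot⟩ => ?_) hu
  have hσv := (map_mem_mid_iff hc h01 σ).2 hv
  rw [mem_image_genX1_smul_iff hv, ← coe_map_le_five_eighths_iff hc h01 σ hv,
    ← mem_image_genX1_smul_iff hσv] at hroot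
  exact ⟨hσv, hroot⟩

theorem map_mul_smul_of_mem_mid (hu : u ∈ mid c) :
    σ ((genX1 * genX0⁻¹) • u) = (genX1 * genX0⁻¹) • σ u := by
  refine (isRayBundle_mid_highLink hc).map_comm (σ := σ.toEquiv)
    (fun _ _ => highLink_map_iff hc h01 σ) (fun _ => map_mem_mid_iff hc h01 σ)
    (fun v ⟨hv, hroot⟩ => ?_) hu
  have hσv := (map_mem_mid_iff hc h01 σ).2 hv
  rw [mem_image_mul_smul_iff hv, ← not_le, ← coe_map_le_five_eighths_iff hc h01 σ hv, not_le,
    ← mem_image_mul_smul_iff hσv] at hroot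
  exact ⟨hσv, hroot⟩

theorem map_eq_self_of_mem_mid (hv : v ∈ mid c) : σ v = v := by
  have hmid {u : V} (hu : u ∈ mid c) : σ u ∈ mid c := (map_mem_mid_iff hc h01 σ).2 hu
  refine hc (Subtype.val_injective (sub_eq_zero.1 ?_))
  refine eq_zero_of_norm_le_mul (Q := mid c) (d := fun v => (c (σ v) : ℝ) - c v)
    (C := 1) (k := 1 / 2) (by norm_num) (by norm_num) (fun u _ => ?_) (fun v hv => ?_) v hv
  · rw [Real.norm_eq_abs, abs_le]
    constructor <;> linarith [(c u).2.1, (c u).2.2, (c (σ u)).2.1, (c (σ u)).2.2]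
  · have of_half {w : V} (h : (c (σ v) : ℝ) - c v = 1 / 2 * (c (σ w) - c w)) :
        ‖(c (σ v) : ℝ) - c v‖ ≤ 1 / 2 * ‖(c (σ w) : ℝ) - c w‖ := by
      rw [h, norm_mul]
      norm_num
    rcases le_or_gt (c v : ℝ) (5 / 8) with h | h
    · obtain ⟨w, hw, rfl⟩ := (mem_image_genX1_smul_iff hv).2 h
      refine ⟨w, hw, of_half ?_⟩
      rw [map_genX1_smul_of_mem_mid hc h01 σ hw, coe_genX1_smul_of_mem_mid (hmid hw),
        coe_genX1_smul_of_mem_mid hw]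
      ring
    · obtain ⟨w, hw, rfl⟩ := (mem_image_mul_smul_iff hv).2 h
      refine ⟨w, hw, of_half ?_⟩
      rw [map_mul_smul_of_mem_mid hc h01 σ hw, coe_mul_smul_of_mem_mid (hmid hw),
        coe_mul_smul_of_mem_mid hw]
      ring

theorem map_eq_self_of_mem_high_of_le (hv : v ∈ high c) (hv' : (c v : ℝ) ≤ 7 / 8) : σ v = v := by
  have h₀ : (c (genX0 • v) : ℝ) = 2 * c v - 1 := by
    rw [coe_genX0_smul]
    grind [high, x0Fun]
  have h₁ : (c (genX1 • v) : ℝ) = c v - 1 / 8 := by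
    rw [coe_genX1_smul]
    grind [high, x1Fun]
  have hm₀ : genX0 • v ∈ mid c := by grind [high, mid]
  have hm₁ : genX1 • v ∈ mid c := by grind [high, mid]
  have hσv : 3 / 4 < (c (σ v) : ℝ) := (map_mem_high_iff hc h01 σ).2 hv
  have nbr {w : V} (hw : w ∈ mid c) (hvw : (thompsonGraph V).Adj v w) :
      (c (σ v) : ℝ) = c w / 2 + 1 / 2 ∨ (c (σ v) : ℝ) = c w + 1 / 8 := by
    rw [← σ.map_rel_iff, map_eq_self_of_mem_mid hc h01 σ hw] at hvw
    exact ((thompsonGraph_adj_iff hc).1 hvw.symm).mid_high hw hσv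
  have := nbr hm₀ (thompsonGraph_adj_genX0_smul v)
  have := nbr hm₁ (thompsonGraph_adj_genX1_smul v)
  refine hc (Subtype.val_injective ?_)
  grind

theorem map_eq_self_of_mem_high (hv : v ∈ high c) : σ v = v := by
  refine (isRayBundle_high hc).map_eq_self (σ := σ.toEquiv) (fun _ _ => σ.map_rel_iff.2)
    (fun _ => (map_mem_high_iff hc h01 σ).2)
    (fun u hu => map_eq_self_of_mem_high_of_le hc h01 σ hu.1 (coe_le_of_mem_high_diff_image hu))
    hv fun heq => ?_
  have := coe_genX0_inv_smul_of_mem_high hv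
  rw [heq] at this
  linarith [(h01 v).2]

theorem map_eq_self_of_mem_low_of_lt (hv : v ∈ low c) (hv' : 1 / 4 < (c v : ℝ)) : σ v = v := by
  have hcoe : (c (genX0⁻¹ • v) : ℝ) = c v + 1 / 4 := by
    rw [coe_genX0_inv_smul]
    grind [low, x0Inv]
  have hmid : genX0⁻¹ • v ∈ mid c := by grind [low, mid]
  have hadj := σ.map_rel_iff.2 (thompsonGraph_adj_genX0_inv_smul v)
  rw [map_eq_self_of_mem_mid hc h01 σ hmid, thompsonGraph_adj_iff hc] at hadj
  have := (hadj.of_low ((map_mem_low_iff hc h01 σ).2 hv) hmid.1).2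
  exact hc (Subtype.val_injective (by linarith))

theorem map_eq_self_of_mem_low (hv : v ∈ low c) : σ v = v := by
  refine (isRayBundle_low hc).map_eq_self (σ := σ.toEquiv) (fun _ _ => σ.map_rel_iff.2)
    (fun _ => (map_mem_low_iff hc h01 σ).2)
    (fun u hu => map_eq_self_of_mem_low_of_lt hc h01 σ hu.1 (lt_coe_of_mem_low_diff_image hu))
    hv fun heq => ?_
  have := coe_genX0_smul_of_mem_low hv
  rw [heq] at this
  linarith [(h01 v).1]

theorem map_eq_self : σ v = v := by
  by_cases hlow : v ∈ low c
  · exact map_eq_self_of_mem_low hc h01 σ hlow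
  by_cases hmid : v ∈ mid c
  · exact map_eq_self_of_mem_mid hc h01 σ hmid
  exact map_eq_self_of_mem_high hc h01 σ (mem_high_iff.2 ⟨hlow, hmid⟩)

end Automorphism

end thompsonGraph

end ThompsonGraph

theorem mainTheorem9_general {V : Type*} [MulAction thompsonF V] {c : V →[thompsonF] unitInterval}
    (hc : Function.Injective c) (h01 : ∀ v, (c v : ℝ) ∈ Set.Ioo 0 1) :
    (thompsonGraph V).markedAut = ⊥ ∧ (thompsonGraph V).unmarkedAut = ⊥ := by
  have hunmarked : (thompsonGraph V).unmarkedAut = ⊥ := (Subgroup.eq_bot_iff_forall _).2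
    fun τ hτ => Equiv.ext fun _ => thompsonGraph.map_eq_self hc h01
      ⟨τ, LabelledDigraph.adj_map_iff_of_mem_unmarkedAut hτ _ _⟩
  exact ⟨eq_bot_mono (LabelledDigraph.markedAut_le_unmarkedAut _) hunmarked, hunmarked⟩

theorem coe_mem_Ioo_of_mem_orbit {x y : unitInterval} (hx0 : 0 < x) (hx1 : x < 1)
    (hy : y ∈ MulAction.orbit thompsonF x) : (y : ℝ) ∈ Set.Ioo 0 1 := by
  obtain ⟨g, rfl⟩ := hy
  exact ⟨unitInterval.nonneg'.trans_lt (g.2.1 hx0), (g.2.1 hx1).trans_le unitInterval.le_one'⟩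

theorem mainTheorem9 (x : unitInterval) (hx0 : 0 < x) (hx1 : x < 1) :
    (thompsonSchreier x).markedAut = ⊥ ∧ (thompsonSchreier x).unmarkedAut = ⊥ :=
  mainTheorem9_general (c := ⟨Subtype.val, fun _ _ => rfl⟩) Subtype.val_injective
    fun y => coe_mem_Ioo_of_mem_orbit hx0 hx1 y.2
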